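/- Let $H$ be a separable complex Hilbert space. Let $A$ be a bounded (everywhere defined) linear operator on $H$ and let $B$ be a closed, not necessarily bounded, linear operator in $H$ with domain $D(B)\subseteq H$. Products of operators carry their natural domains, $D(ST)=\{x\in D(T): Tx\in D(S)\}$; $S\subset T$ means $D(S)\subseteq D(T)$ and $Sx=Tx$ for all $x\in D(S)$; and a (possibly unbounded) operator $T$ is called normal if it is densely defined, closed and $TT^*=T^*T$ (with equality of domains). Suppose that $AB$, $A$ and $B$ are all normal. If $$A^*AB\subset BA^*A\quad\text{and}\quad AB^*B\subset B^*BA,$$ then $BA$ is normal. -/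

import Mathlib

noncomputable section

namespace UnboundedOperator

variable {H : Type*} [NormedAddCommGroup H] [InnerProductSpace ℂ H]

/-- The product `S T` of two (possibly unbounded) operators, on its natural domain
`D(S T) = {x ∈ D(T) | T x ∈ D(S)}`. -/
def mul (S T : H →ₗ.[ℂ] H) : H →ₗ.[ℂ] H where
  domain :=
    { carrier := {x | ∃ hx : x ∈ T.domain, T ⟨x, hx⟩ ∈ S.domain}
      zero_mem' := ⟨T.domain.zero_mem, by
        have h : T ⟨0, T.domain.zero_mem⟩ = 0 := T.map_zero
        rw [h]; exact S.domain.zero_mem⟩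
      add_mem' := by
        rintro x y ⟨hx, hTx⟩ ⟨hy, hTy⟩
        refine ⟨T.domain.add_mem hx hy, ?_⟩
        have h : T ⟨x + y, T.domain.add_mem hx hy⟩ = T ⟨x, hx⟩ + T ⟨y, hy⟩ :=
          T.map_add ⟨x, hx⟩ ⟨y, hy⟩
        rw [h]; exact S.domain.add_mem hTx hTy
      smul_mem' := by
        rintro c x ⟨hx, hTx⟩
        refine ⟨T.domain.smul_mem c hx, ?_⟩
        have h : T ⟨c • x, T.domain.smul_mem c hx⟩ = c • T ⟨x, hx⟩ :=
          T.map_smul c ⟨x, hx⟩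
        rw [h]; exact S.domain.smul_mem c hTx }
  toFun :=
    { toFun := fun x => S ⟨T ⟨x.1, x.2.fst⟩, x.2.snd⟩
      map_add' := fun x y => by
        rw [← S.map_add]
        congr 1
        exact Subtype.ext (T.map_add ⟨x.1, x.2.fst⟩ ⟨y.1, y.2.fst⟩)
      map_smul' := fun c x => by
        rw [RingHom.id_apply, ← S.map_smul]
        congr 1
        exact Subtype.ext (T.map_smul c ⟨x.1, x.2.fst⟩) }

infixr:75 " ⬝ₒ " => UnboundedOperator.mul

theorem mem_mul_domain {S T : H →ₗ.[ℂ] H} {x : H} :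
    x ∈ (S ⬝ₒ T).domain ↔ ∃ hx : x ∈ T.domain, T ⟨x, hx⟩ ∈ S.domain :=
  Iff.rfl

theorem mul_apply {S T : H →ₗ.[ℂ] H} {x : H} (hx : x ∈ T.domain) (hTx : T ⟨x, hx⟩ ∈ S.domain) :
    (S ⬝ₒ T) ⟨x, ⟨hx, hTx⟩⟩ = S ⟨T ⟨x, hx⟩, hTx⟩ :=
  rfl

/-- A bounded operator, regarded as an operator with domain the whole space. -/
def ofBounded (A : H →L[ℂ] H) : H →ₗ.[ℂ] H :=
  A.toLinearMap.toPMap ⊤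

/-- A (possibly unbounded) operator `T` is normal if it is densely defined, closed and
`T T* = T* T`, an equality of operators that includes the equality of the domains. Density of the
domain is what makes the adjoint meaningful. -/
structure IsNormal [CompleteSpace H] (T : H →ₗ.[ℂ] H) : Prop where
  dense_domain : Dense (T.domain : Set H)
  isClosed : T.IsClosed
  mul_adjoint : T ⬝ₒ T.adjoint = T.adjoint ⬝ₒ T

end UnboundedOperator

end

open scoped InnerProductSpace

namespace UnboundedOperator

variable {H : Type*} [NormedAddCommGroup H] [InnerProductSpace ℂ H]

/-! Put `T = BA`, `P = A*A`, `Q = B*B`. Both `T*T` and `TT*` are nonnegative self-adjoint, and both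
extend `PQ`: the first because `AQ ⊆ QA`, the second because `Q = BB*`, `AA* = P` and `PB ⊆ BP`. As
`PQ ⊆ QP`, such an extension is unique (`le_of_extends`), so `T*T = TT*`. Working with graphs and
with surjectivity of `1 + T*T` avoids resolvents and the spectral theorem. -/

theorem mem_graph_mul {S T : H →ₗ.[ℂ] H} {x z : H} :
    (x, z) ∈ (S ⬝ₒ T).graph ↔ ∃ y, (x, y) ∈ T.graph ∧ (y, z) ∈ S.graph := by
  simp only [LinearPMap.mem_graph_iff]
  constructor
  · rintro ⟨⟨u, hu, hTu⟩, rfl, rfl⟩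
    exact ⟨T ⟨u, hu⟩, ⟨⟨u, hu⟩, rfl, rfl⟩, ⟨T ⟨u, hu⟩, hTu⟩, rfl, rfl⟩
  · rintro ⟨y, ⟨⟨u, hu⟩, rfl, rfl⟩, ⟨⟨v, hv⟩, hvy, rfl⟩⟩
    obtain rfl : v = T ⟨u, hu⟩ := hvy
    exact ⟨⟨u, hu, hv⟩, rfl, rfl⟩

theorem mem_graph_ofBounded {A : H →L[ℂ] H} {x y : H} :
    (x, y) ∈ (ofBounded A).graph ↔ y = A x := by
  simp only [LinearPMap.mem_graph_iff, ofBounded]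
  constructor
  · rintro ⟨u, rfl, rfl⟩
    rfl
  · rintro rfl
    exact ⟨⟨x, trivial⟩, rfl, rfl⟩

theorem mem_graph_mul_ofBounded {A : H →L[ℂ] H} {S : H →ₗ.[ℂ] H} {x z : H} :
    (x, z) ∈ (S ⬝ₒ ofBounded A).graph ↔ (A x, z) ∈ S.graph := by
  simp only [mem_graph_mul, mem_graph_ofBounded, exists_eq_left]

theorem mem_graph_ofBounded_mul {A : H →L[ℂ] H} {S : H →ₗ.[ℂ] H} {x z : H} :
    (x, z) ∈ (ofBounded A ⬝ₒ S).graph ↔ ∃ y, (x, y) ∈ S.graph ∧ z = A y := by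
  simp only [mem_graph_mul, mem_graph_ofBounded]

theorem mem_graph_adjoint [CompleteSpace H] {T : H →ₗ.[ℂ] H} (hT : Dense (T.domain : Set H))
    {y w : H} :
    (y, w) ∈ T.adjoint.graph ↔ ∀ x v, (x, v) ∈ T.graph → ⟪w, x⟫_ℂ = ⟪y, v⟫_ℂ := by
  constructor
  · intro h x v hx
    obtain ⟨y, rfl, rfl⟩ := (LinearPMap.mem_graph_iff _).1 h
    obtain ⟨x, rfl, rfl⟩ := (LinearPMap.mem_graph_iff _).1 hx
    exact LinearPMap.adjoint_isFormalAdjoint hT y x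
  · intro h
    have h' : ∀ x : T.domain, ⟪w, (x : H)⟫_ℂ = ⟪y, T x⟫_ℂ := fun x => h _ _ (T.mem_graph x)
    have hy := LinearPMap.mem_adjoint_domain_of_exists y ⟨w, h'⟩
    exact (LinearPMap.mem_graph_iff _).2 ⟨⟨y, hy⟩, rfl, LinearPMap.adjoint_apply_eq hT _ h'⟩

theorem isClosed_mul_ofBounded {B : H →ₗ.[ℂ] H} (hB : B.IsClosed) (A : H →L[ℂ] H) :
    (B ⬝ₒ ofBounded A).IsClosed := by
  have h : ((B ⬝ₒ ofBounded A).graph : Set (H × H)) = (Prod.map A id) ⁻¹' B.graph := by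
    ext ⟨x, y⟩
    exact mem_graph_mul_ofBounded
  change _root_.IsClosed ((B ⬝ₒ ofBounded A).graph : Set (H × H))
  rw [h]
  exact IsClosed.preimage (by fun_prop) hB

/-- A symmetric, nonnegative operator `T` such that `1 + T` is onto; equivalently, a nonnegative
self-adjoint operator. -/
structure IsNonnegSelfAdjoint (T : H →ₗ.[ℂ] H) : Prop where
  symm : ∀ {x y u v : H}, (x, y) ∈ T.graph → (u, v) ∈ T.graph → ⟪y, u⟫_ℂ = ⟪x, v⟫_ℂ
  nonneg : ∀ {x y : H}, (x, y) ∈ T.graph → 0 ≤ (⟪y, x⟫_ℂ).re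
  surj : ∀ w : H, ∃ x y, (x, y) ∈ T.graph ∧ x + y = w

namespace IsNonnegSelfAdjoint

variable {Q T T₁ T₂ : H →ₗ.[ℂ] H}

/-- Nonnegativity gives `‖x‖² ≤ Re ⟪x + Tx, x⟫`; in particular `1 + T` is injective. -/
theorem eq_zero (hT : IsNonnegSelfAdjoint T) {x y : H} (h : (x, y) ∈ T.graph)
    (hxy : ⟪x + y, x⟫_ℂ = 0) : x = 0 := by
  have h0 := hT.nonneg h
  rw [inner_add_left] at hxy
  have h1 := congrArg Complex.re hxy
  have h2 : (⟪x, x⟫_ℂ).re = ‖x‖ ^ 2 := inner_self_eq_norm_sq (𝕜 := ℂ) x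
  rw [Complex.add_re, h2, Complex.zero_re] at h1
  have h3 : ‖x‖ ^ 2 = 0 := by nlinarith [sq_nonneg ‖x‖]
  simpa using h3

theorem dense_domain [CompleteSpace H] (hT : IsNonnegSelfAdjoint T) :
    Dense (T.domain : Set H) := by
  rw [Submodule.dense_iff_topologicalClosure_eq_top, Submodule.topologicalClosure_eq_top_iff,
    Submodule.eq_bot_iff]
  intro w hw
  obtain ⟨x, y, hxy, rfl⟩ := hT.surj w
  have hx := hT.eq_zero hxy
    ((Submodule.mem_orthogonal' _ _).1 hw x (LinearPMap.mem_domain_of_mem_graph hxy))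
  rw [hx, T.graph_fst_eq_zero_snd hxy hx, add_zero]

/-- A nonnegative self-adjoint operator contains its adjoint. -/
theorem mem_graph_of_forall (hT : IsNonnegSelfAdjoint T) {x y : H}
    (h : ∀ u v, (u, v) ∈ T.graph → ⟪y, u⟫_ℂ = ⟪x, v⟫_ℂ) : (x, y) ∈ T.graph := by
  obtain ⟨a, b, hab, hw⟩ := hT.surj (x + y)
  have hxa : x = a := by
    obtain ⟨u, v, huv, hu⟩ := hT.surj (x - a)
    have h1 := h u v huv
    have h2 := hT.symm hab huv
    have h3 : ⟪x - a, u + v⟫_ℂ = ⟪(x + y) - (a + b), u⟫_ℂ := by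
      simp only [inner_add_left, inner_sub_left, inner_add_right, h1, h2]
      ring
    rw [hw, sub_self, inner_zero_left, hu, inner_self_eq_zero, sub_eq_zero] at h3
    exact h3
  subst hxa
  rwa [← add_left_cancel hw]

/-- If a bounded symmetric `P` satisfies `P Q ⊆ Q P`, then `P Q` has at most one nonnegative
self-adjoint extension. -/
theorem le_of_extends (hQ : IsNonnegSelfAdjoint Q) (h₁ : IsNonnegSelfAdjoint T₁)
    (h₂ : IsNonnegSelfAdjoint T₂) {P : H →L[ℂ] H} (hP : ∀ x y, ⟪P x, y⟫_ℂ = ⟪x, P y⟫_ℂ)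
    (hPQ : ∀ {x y}, (x, y) ∈ Q.graph → (P x, P y) ∈ Q.graph)
    (hQ₁ : ∀ {x y}, (x, y) ∈ Q.graph → (x, P y) ∈ T₁.graph)
    (hQ₂ : ∀ {x y}, (x, y) ∈ Q.graph → (x, P y) ∈ T₂.graph) : T₁ ≤ T₂ := by
  -- With `R = (1 + Q)⁻¹`, `r = Rx` and `s = R(x + y)`, this says `(1 + PQ)Rx = R(1 + T)x`.
  have key : ∀ {T : H →ₗ.[ℂ] H}, IsNonnegSelfAdjoint T →
      (∀ {x y}, (x, y) ∈ Q.graph → (x, P y) ∈ T.graph) →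
      ∀ {x y r q s t}, (x, y) ∈ T.graph → (r, q) ∈ Q.graph → r + q = x →
        (s, t) ∈ Q.graph → s + t = x + y → r + P q = s := by
    intro T hT hQT x y r q s t hxy hrq hx hst hs
    -- Self-adjointness turns `PQ ⊆ T` into `T ⊆ QP`.
    have hPx : (P x, y) ∈ Q.graph := hQ.mem_graph_of_forall fun u v huv => by
      rw [hT.symm hxy (hQT huv), hP]
    have hPq : (P q, y - P q) ∈ Q.graph := by
      have := Q.graph.sub_mem hPx (hPQ hrq)
      rwa [Prod.mk_sub_mk, ← map_sub, ← hx, add_sub_cancel_left] at this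
    have h3 := Q.graph.sub_mem (Q.graph.add_mem hrq hPq) hst
    have h4 := hQ.eq_zero h3 (by
      simp only [Prod.mk_add_mk]
      have : r + P q - s + (q + (y - P q) - t) = (r + q) + y - (s + t) := by abel
      simp [this, hs, hx])
    exact sub_eq_zero.1 h4
  refine LinearPMap.le_of_le_graph ?_
  rintro ⟨x, y⟩ hxy
  obtain ⟨x', y', hxy', hw⟩ := h₂.surj (x + y)
  obtain ⟨r, q, hrq, hx⟩ := hQ.surj x
  obtain ⟨r', q', hrq', hx'⟩ := hQ.surj x'
  obtain ⟨s, t, hst, hs⟩ := hQ.surj (x + y)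
  have e₁ := key h₁ hQ₁ hxy hrq hx hst hs
  have e₂ := key h₂ hQ₂ hxy' hrq' hx' hst (hs.trans hw.symm)
  have hd := Q.graph.sub_mem hrq hrq'
  -- `1 + PQ` is injective because `1 + T₁` extends it.
  have hr : r - r' = 0 := h₁.eq_zero (hQ₁ hd) (by
    have : r - r' + P (q - q') = (r + P q) - (r' + P q') := by rw [map_sub]; abel
    change ⟪r - r' + P (q - q'), r - r'⟫_ℂ = 0
    rw [this, e₁, e₂, sub_self, inner_zero_left])
  have hq : q - q' = 0 := Q.graph_fst_eq_zero_snd hd hr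
  have hxx : x = x' := by rw [← hx, ← hx', sub_eq_zero.1 hr, sub_eq_zero.1 hq]
  subst hxx
  rwa [← add_left_cancel hw]

end IsNonnegSelfAdjoint

variable [CompleteSpace H]

/-- The orthogonal decomposition of `H × H` into the graph of `T` and the rotated graph of the
adjoint of `T`. -/
theorem exists_graph_add_adjoint {T : H →ₗ.[ℂ] H} (hd : Dense (T.domain : Set H))
    (hc : T.IsClosed) (a b : H) :
    ∃ x y u v, (x, y) ∈ T.graph ∧ (u, v) ∈ T.adjoint.graph ∧ a = x - v ∧ b = y + u := by
  let e := WithLp.prodContinuousLinearEquiv 2 ℂ H H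
  let G : Submodule ℂ (WithLp 2 (H × H)) := T.graph.comap e.toLinearMap
  have hG : IsClosed (G : Set (WithLp 2 (H × H))) := hc.preimage e.continuous
  have : CompleteSpace G := hG.completeSpace_coe
  obtain ⟨g, hg, p, hp, hw⟩ := G.exists_add_mem_mem_orthogonal (WithLp.toLp 2 (a, b))
  refine ⟨g.fst, g.snd, p.snd, -p.fst, hg, ?_, ?_, ?_⟩
  · rw [mem_graph_adjoint hd]
    intro x v hxv
    have h := (G.mem_orthogonal' p).1 hp (WithLp.toLp 2 (x, v)) hxv
    rw [WithLp.prod_inner_apply] at h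
    rw [inner_neg_left]
    exact neg_eq_of_add_eq_zero_right h
  · have := congrArg WithLp.fst hw
    simpa using this
  · have := congrArg WithLp.snd hw
    simpa using this

/-- Von Neumann's theorem: decomposing `(w, 0)` along the graph of `T` solves `x + T*Tx = w`. For
`TT*` one decomposes `(0, w)`. -/
theorem isNonnegSelfAdjoint_adjoint_mul_self {T : H →ₗ.[ℂ] H} (hd : Dense (T.domain : Set H))
    (hc : T.IsClosed) : IsNonnegSelfAdjoint (T.adjoint ⬝ₒ T) where
  symm {x y u v} hxy huv := by
    obtain ⟨z, hxz, hzy⟩ := mem_graph_mul.1 hxy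
    obtain ⟨w, huw, hwv⟩ := mem_graph_mul.1 huv
    rw [(mem_graph_adjoint hd).1 hzy _ _ huw, ← inner_conj_symm x,
      (mem_graph_adjoint hd).1 hwv _ _ hxz, inner_conj_symm]
  nonneg {x y} hxy := by
    obtain ⟨z, hxz, hzy⟩ := mem_graph_mul.1 hxy
    rw [(mem_graph_adjoint hd).1 hzy _ _ hxz]
    exact inner_self_nonneg (𝕜 := ℂ)
  surj w := by
    obtain ⟨x, y, u, v, hxy, huv, ha, hb⟩ := exists_graph_add_adjoint hd hc w 0
    refine ⟨x, -v, mem_graph_mul.2 ⟨y, hxy, ?_⟩, by rw [ha]; abel⟩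
    rw [eq_neg_of_add_eq_zero_left hb.symm]
    exact T.adjoint.graph.neg_mem huv

theorem isNonnegSelfAdjoint_self_mul_adjoint {T : H →ₗ.[ℂ] H} (hd : Dense (T.domain : Set H))
    (hc : T.IsClosed) : IsNonnegSelfAdjoint (T ⬝ₒ T.adjoint) where
  symm {x y u v} hxy huv := by
    obtain ⟨z, hxz, hzy⟩ := mem_graph_mul.1 hxy
    obtain ⟨w, huw, hwv⟩ := mem_graph_mul.1 huv
    rw [← (mem_graph_adjoint hd).1 hxz _ _ hwv, ← inner_conj_symm y,
      ← (mem_graph_adjoint hd).1 huw _ _ hzy, inner_conj_symm]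
  nonneg {x y} hxy := by
    obtain ⟨z, hxz, hzy⟩ := mem_graph_mul.1 hxy
    rw [← inner_conj_symm, ← (mem_graph_adjoint hd).1 hxz _ _ hzy, Complex.conj_re]
    exact inner_self_nonneg (𝕜 := ℂ)
  surj w := by
    obtain ⟨x, y, u, v, hxy, huv, ha, hb⟩ := exists_graph_add_adjoint hd hc 0 w
    refine ⟨u, y, mem_graph_mul.2 ⟨v, huv, ?_⟩, by rw [hb]; abel⟩
    rwa [← sub_eq_zero.1 ha.symm]

/-- The adjoint of `B A` extends `A* B*`. -/
theorem mem_graph_adjoint_mul_ofBounded {B : H →ₗ.[ℂ] H} {A : H →L[ℂ] H}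
    (hB : Dense (B.domain : Set H)) (hBA : Dense ((B ⬝ₒ ofBounded A).domain : Set H)) {x y : H}
    (h : (x, y) ∈ B.adjoint.graph) :
    (x, ContinuousLinearMap.adjoint A y) ∈ (B ⬝ₒ ofBounded A).adjoint.graph := by
  rw [mem_graph_adjoint hBA]
  intro u v huv
  rw [ContinuousLinearMap.adjoint_inner_left]
  exact (mem_graph_adjoint hB).1 h _ _ (mem_graph_mul_ofBounded.1 huv)

end UnboundedOperator

open UnboundedOperator in
theorem mainTheorem5 {H : Type*} [NormedAddCommGroup H] [InnerProductSpace ℂ H] [CompleteSpace H]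
    [TopologicalSpace.SeparableSpace H]
    (A : H →L[ℂ] H) (B : H →ₗ.[ℂ] H)
    (hBclosed : B.IsClosed)
    (hAB : UnboundedOperator.IsNormal (UnboundedOperator.ofBounded A ⬝ₒ B))
    (hA : IsStarNormal A)
    (hB : UnboundedOperator.IsNormal B)
    (h₁ : UnboundedOperator.ofBounded (ContinuousLinearMap.adjoint A) ⬝ₒ
        UnboundedOperator.ofBounded A ⬝ₒ B ≤
      B ⬝ₒ UnboundedOperator.ofBounded (ContinuousLinearMap.adjoint A) ⬝ₒ
        UnboundedOperator.ofBounded A)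
    (h₂ : UnboundedOperator.ofBounded A ⬝ₒ B.adjoint ⬝ₒ B ≤
      B.adjoint ⬝ₒ B ⬝ₒ UnboundedOperator.ofBounded A) :
    UnboundedOperator.IsNormal (B ⬝ₒ UnboundedOperator.ofBounded A) := by
  have hBd := hB.dense_domain
  set P : H →L[ℂ] H := ContinuousLinearMap.adjoint A * A with hPdef
  have hPapp : ∀ x, P x = ContinuousLinearMap.adjoint A (A x) := fun x => rfl
  -- Normality of `A` enters here.
  have hPapp' : ∀ x, P x = A (ContinuousLinearMap.adjoint A x) := fun x =>
    DFunLike.congr_fun hA.star_comm_self.eq x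
  have hP : ∀ x y, ⟪P x, y⟫_ℂ = ⟪x, P y⟫_ℂ := fun x y => by
    rw [hPapp, hPapp, ContinuousLinearMap.adjoint_inner_left,
      ContinuousLinearMap.adjoint_inner_right]
  have hPB : ∀ {x y}, (x, y) ∈ B.graph → (P x, P y) ∈ B.graph := fun {x y} h => by
    have h' := LinearPMap.le_graph_of_le h₁ (mem_graph_ofBounded_mul.2
      ⟨_, mem_graph_ofBounded_mul.2 ⟨_, h, rfl⟩, rfl⟩)
    obtain ⟨z, hz, hz'⟩ := mem_graph_mul.1 h'
    obtain ⟨z', hz1, rfl⟩ := mem_graph_ofBounded_mul.1 hz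
    rwa [mem_graph_ofBounded.1 hz1] at hz'
  have hPB' : ∀ {x y}, (x, y) ∈ B.adjoint.graph → (P x, P y) ∈ B.adjoint.graph := fun {x y} h =>
    (mem_graph_adjoint hBd).2 fun u v huv => by
      rw [hP, hP]
      exact (mem_graph_adjoint hBd).1 h _ _ (hPB huv)
  have hQ := isNonnegSelfAdjoint_adjoint_mul_self hBd hBclosed
  have hAQ : ∀ {x y}, (x, y) ∈ (B.adjoint ⬝ₒ B).graph →
      ∃ z, (A x, z) ∈ B.graph ∧ (z, A y) ∈ B.adjoint.graph := fun {x y} h => by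
    obtain ⟨z, hz, hz'⟩ := mem_graph_mul.1
      (LinearPMap.le_graph_of_le h₂ (mem_graph_ofBounded_mul.2 ⟨y, h, rfl⟩))
    exact ⟨z, mem_graph_mul_ofBounded.1 hz, hz'⟩
  have hTc := isClosed_mul_ofBounded hBclosed A
  -- By `AQ ⊆ QA`, the domain of `BA` contains the dense domain of `Q`.
  have hTd : Dense ((B ⬝ₒ ofBounded A).domain : Set H) := by
    refine hQ.dense_domain.mono fun x hx => ?_
    obtain ⟨z, hz, -⟩ := hAQ (LinearPMap.mem_graph _ ⟨x, hx⟩)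
    exact LinearPMap.mem_domain_of_mem_graph (mem_graph_mul_ofBounded.2 hz)
  have hPQ : ∀ {x y}, (x, y) ∈ (B.adjoint ⬝ₒ B).graph → (P x, P y) ∈ (B.adjoint ⬝ₒ B).graph :=
    fun {x y} h => by
      obtain ⟨z, hz, hz'⟩ := mem_graph_mul.1 h
      exact mem_graph_mul.2 ⟨_, hPB hz, hPB' hz'⟩
  have hQ₁ : ∀ {x y}, (x, y) ∈ (B.adjoint ⬝ₒ B).graph →
      (x, P y) ∈ ((B ⬝ₒ ofBounded A).adjoint ⬝ₒ B ⬝ₒ ofBounded A).graph := fun {x y} h => by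
    obtain ⟨z, hz, hz'⟩ := hAQ h
    exact mem_graph_mul.2 ⟨z, mem_graph_mul_ofBounded.2 hz,
      mem_graph_adjoint_mul_ofBounded hBd hTd hz'⟩
  have hQ₂ : ∀ {x y}, (x, y) ∈ (B.adjoint ⬝ₒ B).graph →
      (x, P y) ∈ ((B ⬝ₒ ofBounded A) ⬝ₒ (B ⬝ₒ ofBounded A).adjoint).graph := fun {x y} h => by
    -- Normality of `B` replaces `B*B` by `BB*`, so that `TT*x = BAA*B*x = PBB*x`.
    rw [← hB.mul_adjoint] at h
    obtain ⟨z, hz, hz'⟩ := mem_graph_mul.1 h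
    refine mem_graph_mul.2 ⟨_, mem_graph_adjoint_mul_ofBounded hBd hTd hz,
      mem_graph_mul_ofBounded.2 ?_⟩
    rw [← hPapp']
    exact hPB hz'
  have hN₁ := isNonnegSelfAdjoint_adjoint_mul_self hTd hTc
  have hN₂ := isNonnegSelfAdjoint_self_mul_adjoint hTd hTc
  exact ⟨hTd, hTc, le_antisymm (hQ.le_of_extends hN₂ hN₁ hP hPQ hQ₂ hQ₁)
    (hQ.le_of_extends hN₁ hN₂ hP hPQ hQ₁ hQ₂)⟩
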